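/- Let $\mathcal X,\mathcal Y$ be finite-dimensional real Hilbert spaces with Lebesgue measure, $\Theta$ a parameter set, $\theta\in\Theta$ fixed, $Q\ge 1$ and $\nu>0$ (in particular $\nu\in\,]0,2/L[$ is allowed). Let $F:\mathcal X\times\mathcal Y\times\Theta\to\mathbb R$ be such that, for every $y$, $F(\cdot,y,\theta)$ is convex and $C^1$ with $L$-Lipschitz gradient $\nabla_1F(\cdot,y,\theta)$. For $k=1,\dots,Q$ let $G_k(\cdot,y,\theta):\mathcal X\to\,]-\infty,+\infty]$ be proper, closed and convex for every $y$, and write $\mathrm{Prox}_{\nu QG_k}(x,y,\theta)=\operatorname{argmin}_{z}\ \tfrac12\|z-x\|^2+\nu Q\,G_k(z,y,\theta)$. Put $a=(\xi,z_1,\dots,z_Q)\in\mathcal A=\mathcal X^{1+Q}$, $\gamma(a)=\xi$, and consider the Generalized Forward--Backward iterates $x^{(\ell)}=\gamma(a^{(\ell)})$, $a^{(\ell+1)}=\psi(a^{(\ell)},y,\theta)$ given by $$x^{(\ell+1)}=\tfrac1Q\sum_{k=1}^Q z_k^{(\ell+1)},\quad z_k^{(\ell+1)}=z_k^{(\ell)}-x^{(\ell)}+\mathrm{Prox}_{\nu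 QG_k}(Z_k^{(\ell)},y,\theta),\quad Z_k^{(\ell)}=2x^{(\ell)}-z_k^{(\ell)}-\nu\nabla_1F(x^{(\ell)},y,\theta),$$ started at some $a^{(0)}(y,\theta)$. Assume that $y\mapsto a^{(0)}(y,\theta)$ is Lipschitz and that $y\mapsto\nabla_1F(x,y,\theta)$ and $y\mapsto\mathrm{Prox}_{\nu QG_k}(x,y,\theta)$ are Lipschitz with constants independent of $x$. Then, for all $\ell$ and $k$, the maps $a^{(\ell)}$, $x^{(\ell)}$, $z_k^{(\ell)}$, $Z_k^{(\ell)}$ are weakly differentiable in $y$. Moreover one can choose versions of the partial weak Jacobians (in the first and in the second argument, for every fixed value of the other one) of $\psi(\cdot,\cdot,\theta)$, $\mathrm{Prox}_{\nu QG_k}(\cdot,\cdot,\theta)$ and $\nabla_1F(\cdot,\cdot,\theta)$, and of the weak Jacobian of $\gamma$, each of which equals the classical (partial) Jacobian at every point where the latter exists, such that the following holds. Let $D_a^{(\ell)},D_x^{(\ell)},D_{z_k}^{(\ell)},D_{Z_k}^{(\ell)}$ denote the weak Jacobians in $y$ of $a^{(\ell)},x^{(\ell)},z_k^{(\ell)},Z_k^{(\ell)}$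 (any versions) applied to a direction $\delta$. For almost every $y\in\mathcal Y$, all $\delta\in\mathcal Y$, all $\ell\ge0$ and all $k$, one has $D_a^{(\ell)}=(D_x^{(\ell)},D_{z_1}^{(\ell)},\dots,D_{z_Q}^{(\ell)})$, $D_x^{(\ell)}=\Gamma_a^{(\ell)}(D_a^{(\ell)})$, $D_a^{(\ell+1)}=\Psi_a^{(\ell)}(D_a^{(\ell)})+\Psi_y^{(\ell)}(\delta)$, and $$D_x^{(\ell+1)}=\tfrac1Q\sum_{k=1}^QD_{z_k}^{(\ell+1)},\qquad D_{z_k}^{(\ell+1)}=D_{z_k}^{(\ell)}-D_x^{(\ell)}+\mathcal G_{k,x}^{(\ell)}(D_{Z_k}^{(\ell)})+\mathcal G_{k,y}^{(\ell)}(\delta),$$ $$D_{Z_k}^{(\ell)}=2D_x^{(\ell)}-D_{z_k}^{(\ell)}-\nu\big(\mathcal F_x^{(\ell)}(D_x^{(\ell)})+\mathcal F_y^{(\ell)}(\delta)\big),$$ where $\Gamma_a^{(\ell)}$ is the Jacobian of $\gamma$ at $a^{(\ell)}$; $\Psi_a^{(\ell)},\Psi_y^{(\ell)}$ are the chosen Jacobians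 of $\psi$ in its first and second argument at $(a^{(\ell)},y,\theta)$; $\mathcal G_{k,x}^{(\ell)},\mathcal G_{k,y}^{(\ell)}$ those of $\mathrm{Prox}_{\nu QG_k}$ at $(Z_k^{(\ell)},y,\theta)$; and $\mathcal F_x^{(\ell)},\mathcal F_y^{(\ell)}$ those of $\nabla_1F$ at $(x^{(\ell)},y,\theta)$. Furthermore, for these $y,\delta,\ell,k$, the vector $\Psi_a^{(\ell)}(D_a^{(\ell)})+\Psi_y^{(\ell)}(\delta)$ is the directional derivative of $\psi(\cdot,\cdot,\theta)$ at $(a^{(\ell)},y)$ along $(D_a^{(\ell)},\delta)$, $\mathcal G_{k,x}^{(\ell)}(D_{Z_k}^{(\ell)})+\mathcal G_{k,y}^{(\ell)}(\delta)$ is that of $\mathrm{Prox}_{\nu QG_k}(\cdot,\cdot,\theta)$ at $(Z_k^{(\ell)},y)$ along $(D_{Z_k}^{(\ell)},\delta)$, and $\mathcal F_x^{(\ell)}(D_x^{(\ell)})+\mathcal F_y^{(\ell)}(\delta)$ is that of $\nabla_1F(\cdot,\cdot,\theta)$ at $(x^{(\ell)},y)$ along $(D_x^{(\ell)},\delta)$.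 -/

import Mathlib

open MeasureTheory
open scoped NNReal

noncomputable section

/-! ### Weak Jacobians -/

section Weak

variable {E W : Type*} [NormedAddCommGroup E] [NormedSpace ℝ E] [MeasureSpace E]
  [NormedAddCommGroup W] [NormedSpace ℝ W]

/-- `J` is (a version of) the weak Jacobian of `h` on the whole space `E`: both are locally
integrable and the integration by parts formula against every `C¹` test function with compact
support holds, for the partial derivative in every direction `v`. A weak Jacobian is only
determined up to a Lebesgue-null set. -/
structure IsWeakJacobian (h : E → W) (J : E → E →L[ℝ] W) : Prop where
  locallyIntegrable_fun : LocallyIntegrable h volume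
  locallyIntegrable_jac : LocallyIntegrable J volume
  integral_eq : ∀ (v : E) (φ : E → ℝ), ContDiff ℝ 1 φ → HasCompactSupport φ →
    ∫ a, φ a • J a v = - ∫ a, fderiv ℝ φ a v • h a

/-- `h` is weakly differentiable. -/
def WeaklyDifferentiable (h : E → W) : Prop :=
  ∃ J : E → E →L[ℝ] W, IsWeakJacobian h J

/-- `J` is a version of the weak Jacobian of `h` which, at every point at which `h` is
differentiable in the classical (Fréchet) sense, is equal to the classical Jacobian of `h`. -/
structure IsPointwiseWeakJacobian (h : E → W) (J : E → E →L[ℝ] W) : Prop where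
  isWeakJacobian : IsWeakJacobian h J
  eq_fderiv : ∀ a, DifferentiableAt ℝ h a → J a = fderiv ℝ h a

end Weak

/-! ### Convex functions and proximal maps -/

section Prox

variable {X : Type*} [NormedAddCommGroup X] [InnerProductSpace ℝ X]

/-- An extended-real-valued function is proper, closed (lower semicontinuous) and convex
(its epigraph is convex). -/
structure IsProperClosedConvex (G : X → EReal) : Prop where
  ne_bot : ∀ x, G x ≠ ⊥
  exists_ne_top : ∃ x, G x ≠ ⊤
  closed : LowerSemicontinuous G
  convex : Convex ℝ {p : X × ℝ | G p.1 ≤ (p.2 : EReal)}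

/-- The proximal map of `G` at `x`: the minimizer `z` of `‖z - x‖² / 2 + G z`
(which exists and is unique if `G` is proper, closed and convex). -/
def prox (G : X → EReal) (x : X) : X :=
  Classical.epsilon fun p : X =>
    ∀ z : X, ((1 / 2 * ‖p - x‖ ^ 2 : ℝ) : EReal) + G p ≤ ((1 / 2 * ‖z - x‖ ^ 2 : ℝ) : EReal) + G z

end Prox

/-! ### Generalized Forward-Backward splitting -/

section GFB

variable {X Y Θ : Type*} [NormedAddCommGroup X] [InnerProductSpace ℝ X] [CompleteSpace X] {Q : ℕ}

/-- The gradient of `F` with respect to its first argument. -/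
def gradFst (F : X → Y → Θ → ℝ) (x : X) (y : Y) (θ : Θ) : X :=
  gradient (fun x' => F x' y θ) x

/-- `Prox_{ν Q G_k}(x, y, θ)`, the proximal map being taken in the first argument. -/
def gfbProx (ν : ℝ) (G : Fin Q → X → Y → Θ → EReal) (k : Fin Q) (x : X) (y : Y) (θ : Θ) : X :=
  prox (fun x' => ((ν * (Q : ℝ) : ℝ) : EReal) * G k x' y θ) x

/-- The output map `γ` on the auxiliary variable `a = (ξ, z_1, …, z_Q)`. -/
def gfbGamma (a : X × (Fin Q → X)) : X := a.1

/-- `Z_k = 2 x - z_k - ν ∇₁F(x, y, θ)`, with `a = (x, z_1, …, z_Q)`. -/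
def gfbZ (ν : ℝ) (F : X → Y → Θ → ℝ) (k : Fin Q) (a : X × (Fin Q → X)) (y : Y) (θ : Θ) : X :=
  (2 : ℝ) • gfbGamma a - a.2 k - ν • gradFst F (gfbGamma a) y θ

/-- The new value `z_k - x + Prox_{ν Q G_k}(Z_k, y, θ)` of the variable `z_k`. -/
def gfbNewz (ν : ℝ) (F : X → Y → Θ → ℝ) (G : Fin Q → X → Y → Θ → EReal)
    (a : X × (Fin Q → X)) (y : Y) (θ : Θ) (k : Fin Q) : X :=
  a.2 k - gfbGamma a + gfbProx ν G k (gfbZ ν F k a y θ) y θ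

/-- The iteration map `ψ(a, y, θ)`. -/
def gfbPsi (ν : ℝ) (F : X → Y → Θ → ℝ) (G : Fin Q → X → Y → Θ → EReal)
    (a : X × (Fin Q → X)) (y : Y) (θ : Θ) : X × (Fin Q → X) :=
  ((1 / (Q : ℝ)) • ∑ k, gfbNewz ν F G a y θ k, gfbNewz ν F G a y θ)

/-- The auxiliary iterates `a^(ℓ)(y, θ)` started at `a₀(y, θ)`. -/
def gfbA (ν : ℝ) (F : X → Y → Θ → ℝ) (G : Fin Q → X → Y → Θ → EReal)
    (a₀ : Y → Θ → X × (Fin Q → X)) : ℕ → Y → Θ → X × (Fin Q → X)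
  | 0, y, θ => a₀ y θ
  | ℓ + 1, y, θ => gfbPsi ν F G (gfbA ν F G a₀ ℓ y θ) y θ

/-- The iterates `x^(ℓ)(y, θ) = γ(a^(ℓ)(y, θ))`. -/
def gfbX (ν : ℝ) (F : X → Y → Θ → ℝ) (G : Fin Q → X → Y → Θ → EReal)
    (a₀ : Y → Θ → X × (Fin Q → X)) (ℓ : ℕ) (y : Y) (θ : Θ) : X :=
  gfbGamma (gfbA ν F G a₀ ℓ y θ)

/-- The iterates `z_k^(ℓ)(y, θ)`. -/
def gfbz (ν : ℝ) (F : X → Y → Θ → ℝ) (G : Fin Q → X → Y → Θ → EReal)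
    (a₀ : Y → Θ → X × (Fin Q → X)) (ℓ : ℕ) (k : Fin Q) (y : Y) (θ : Θ) : X :=
  (gfbA ν F G a₀ ℓ y θ).2 k

/-- The iterates `Z_k^(ℓ)(y, θ)`. -/
def gfbZIter (ν : ℝ) (F : X → Y → Θ → ℝ) (G : Fin Q → X → Y → Θ → EReal)
    (a₀ : Y → Θ → X × (Fin Q → X)) (ℓ : ℕ) (k : Fin Q) (y : Y) (θ : Θ) : X :=
  gfbZ ν F k (gfbA ν F G a₀ ℓ y θ) y θ

end GFB

end

/-!
Every map in the algorithm is Lipschitz: proximal maps are nonexpansive, and the iterates are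
compositions of Lipschitz maps. By Rademacher's theorem, the weak Jacobians of the iterates are
almost everywhere their classical Jacobians, so the whole difficulty is to differentiate a
composition `y ↦ f (c y) y` of Lipschitz maps. The usual chain rule fails because `c` may send a
set of positive measure into the null set on which a partial derivative of `f` does not exist.

Where both partial derivatives of `f` exist at `(c y, y)`, the chain rule nevertheless holds for
almost every `y`, although `f` need not be differentiable there: `y` is a density point of each of
countably many sets on which the increments of `f` in its first variable are approximated by a
linear map to within `ε`, uniformly. Where one of them does not exist, its weak Jacobian may be
chosen freely at this point. Since `f` is Lipschitz, the derivative of `y ↦ f (c y) y` along `δ` is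
a directional derivative of `f` along `(c' δ, δ)`, so that its difference with the other partial
derivative vanishes whenever `c' δ = 0` and factors through `c'`, which provides the right choice.
-/

section WeakJacobian

variable {E W : Type*} [NormedAddCommGroup E] [NormedSpace ℝ E] [FiniteDimensional ℝ E]
  [MeasureSpace E] [BorelSpace E] [NormedAddCommGroup W] [NormedSpace ℝ W]

theorem locallyIntegrable_clm_apply {F : Type*} [NormedAddCommGroup F] [NormedSpace ℝ F]
    {E : Type*} [TopologicalSpace E] [MeasurableSpace E] {μ : Measure E} {J : E → F →L[ℝ] W}
    (hJ : LocallyIntegrable J μ) (v : F) : LocallyIntegrable (fun a => J a v) μ :=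
  fun a => (ContinuousLinearMap.apply ℝ W v).integrableAtFilter_comp (hJ a)

theorem IsWeakJacobian.ae_eq [CompleteSpace W] {h : E → W} {J J' : E → E →L[ℝ] W}
    (hJ : IsWeakJacobian h J) (hJ' : IsWeakJacobian h J') : J =ᵐ[volume] J' := by
  have eq_apply (v : E) : ∀ᵐ a, J a v = J' a v := by
    refine ae_eq_of_integral_contDiff_smul_eq
      (locallyIntegrable_clm_apply hJ.locallyIntegrable_jac v)
      (locallyIntegrable_clm_apply hJ'.locallyIntegrable_jac v) fun φ hφ hφ' => ?_
    have hφ₁ : ContDiff ℝ 1 φ := hφ.of_le (by simp)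
    rw [hJ.integral_eq v φ hφ₁ hφ', hJ'.integral_eq v φ hφ₁ hφ']
  let b := Module.finBasis ℝ E
  filter_upwards [ae_all_iff.2 fun i => eq_apply (b i)] with a ha
  exact ContinuousLinearMap.coe_injective (b.ext ha)

variable [(volume : Measure E).IsAddHaarMeasure] {C : ℝ≥0}

theorem integral_smul_fderiv_eq_neg_of_lipschitzWith_real {h : E → ℝ} (hh : LipschitzWith C h)
    (v : E) {φ : E → ℝ} (hφ : ContDiff ℝ 1 φ) (hφ' : HasCompactSupport φ) :
    ∫ a, φ a * fderiv ℝ h a v = -∫ a, fderiv ℝ φ a v * h a := by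
  obtain ⟨D, hD⟩ := hφ.lipschitzWith_of_hasCompactSupport hφ' one_ne_zero
  calc ∫ a, φ a * fderiv ℝ h a v = ∫ a, lineDeriv ℝ h a v * φ a := by
        refine integral_congr_ae ?_
        filter_upwards [hh.ae_differentiableAt (μ := volume)] with a ha
        rw [ha.lineDeriv_eq_fderiv, mul_comm]
    _ = ∫ a, lineDeriv ℝ φ a (-v) * h a := hh.integral_lineDeriv_mul_eq (μ := volume) hD hφ' v
    _ = -∫ a, fderiv ℝ φ a v * h a := by
        simp only [(hφ.differentiable one_ne_zero _).lineDeriv_eq_fderiv, map_neg, neg_mul,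
          integral_neg]

variable [FiniteDimensional ℝ W] {h : E → W}

theorem locallyIntegrable_fderiv_of_lipschitzWith (hh : LipschitzWith C h) :
    LocallyIntegrable (fderiv ℝ h) volume := by
  have := FiniteDimensional.complete ℝ W
  borelize (E →L[ℝ] W)
  refine MemLp.locallyIntegrable (p := ⊤) ?_ le_top
  exact memLp_top_of_bound (measurable_fderiv ℝ h).aestronglyMeasurable C
    (.of_forall fun a => norm_fderiv_le_of_lipschitz ℝ hh)

theorem integral_smul_fderiv_eq_neg_of_lipschitzWith (hh : LipschitzWith C h) (v : E) {φ : E → ℝ}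
    (hφ : ContDiff ℝ 1 φ) (hφ' : HasCompactSupport φ) :
    ∫ a, φ a • fderiv ℝ h a v = -∫ a, fderiv ℝ φ a v • h a := by
  have := FiniteDimensional.complete ℝ W
  have integrable_left : Integrable fun a => φ a • fderiv ℝ h a v :=
    (locallyIntegrable_clm_apply (locallyIntegrable_fderiv_of_lipschitzWith hh) v)
      |>.integrable_smul_left_of_hasCompactSupport hφ.continuous hφ'
  have integrable_right : Integrable fun a => fderiv ℝ φ a v • h a :=
    hh.continuous.locallyIntegrable.integrable_smul_left_of_hasCompactSupport
      ((hφ.continuous_fderiv one_ne_zero).clm_apply continuous_const)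
      (hφ'.fderiv_apply (𝕜 := ℝ) v)
  refine (SeparatingDual.eq_iff_forall_dual_eq (R := ℝ)).2 fun T => ?_
  calc T (∫ a, φ a • fderiv ℝ h a v) = ∫ a, φ a * T (fderiv ℝ h a v) := by
        simp only [← T.integral_comp_comm integrable_left, map_smul, smul_eq_mul]
    _ = ∫ a, φ a * fderiv ℝ (T ∘ h) a v := by
        refine integral_congr_ae ?_
        filter_upwards [hh.ae_differentiableAt (μ := volume)] with a ha
        rw [(T.hasFDerivAt.comp a ha.hasFDerivAt).fderiv, ContinuousLinearMap.comp_apply]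
    _ = -∫ a, fderiv ℝ φ a v * T (h a) :=
        integral_smul_fderiv_eq_neg_of_lipschitzWith_real (T.lipschitz.comp hh) v hφ hφ'
    _ = T (-∫ a, fderiv ℝ φ a v • h a) := by
        simp only [map_neg, ← T.integral_comp_comm integrable_right, map_smul, smul_eq_mul]

theorem IsPointwiseWeakJacobian.of_lipschitzWith (hh : LipschitzWith C h) {J : E → E →L[ℝ] W}
    (hJ : ∀ a, DifferentiableAt ℝ h a → J a = fderiv ℝ h a) : IsPointwiseWeakJacobian h J := by
  have fderiv_ae_eq : fderiv ℝ h =ᵐ[volume] J := by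
    filter_upwards [hh.ae_differentiableAt (μ := volume)] with a ha using (hJ a ha).symm
  refine ⟨⟨hh.continuous.locallyIntegrable,
    (locallyIntegrable_fderiv_of_lipschitzWith hh).congr fderiv_ae_eq, fun v φ hφ hφ' => ?_⟩, hJ⟩
  rw [← integral_smul_fderiv_eq_neg_of_lipschitzWith hh v hφ hφ']
  exact integral_congr_ae (fderiv_ae_eq.mono fun a ha => by simp only [ha])

theorem WeaklyDifferentiable.of_lipschitzWith (hh : LipschitzWith C h) : WeaklyDifferentiable h :=
  ⟨fderiv ℝ h, (IsPointwiseWeakJacobian.of_lipschitzWith hh fun _ _ => rfl).isWeakJacobian⟩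

theorem IsWeakJacobian.ae_hasFDerivAt {J : E → E →L[ℝ] W} (hJ : IsWeakJacobian h J)
    (hh : LipschitzWith C h) : ∀ᵐ a, HasFDerivAt h (J a) a := by
  have := FiniteDimensional.complete ℝ W
  filter_upwards [hJ.ae_eq (IsPointwiseWeakJacobian.of_lipschitzWith hh fun _ _ =>
    rfl).isWeakJacobian, hh.ae_differentiableAt (μ := volume)] with a ha ha'
  exact ha ▸ ha'.hasFDerivAt

end WeakJacobian

section TangentCone

open Filter Topology Metric
open scoped Pointwise

variable {A Y W : Type*} [NormedAddCommGroup A] [NormedSpace ℝ A]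
  [NormedAddCommGroup Y] [NormedSpace ℝ Y] [NormedAddCommGroup W] [NormedSpace ℝ W]

theorem mem_tangentConeAt_of_density_one [FiniteDimensional ℝ Y] [MeasurableSpace Y]
    [BorelSpace Y] (μ : Measure Y) [μ.IsAddHaarMeasure] {s : Set Y} {y : Y}
    (hy : Tendsto (fun r => μ (s ∩ closedBall y r) / μ (closedBall y r)) (𝓝[>] 0) (𝓝 1)) (δ : Y) :
    δ ∈ tangentConeAt ℝ s y := by
  have approachable : ∃ᶠ p : ℝ × Y in 𝓝[>] 0 ×ˢ 𝓝 δ, y + p.1 • p.2 ∈ s := by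
    refine ((nhdsGT_basis 0).prod nhds_basis_closedBall).frequently_iff.2 fun ε hε => ?_
    have meets := Measure.eventually_nonempty_inter_smul_of_density_one μ s y hy _
      measurableSet_closedBall (measure_closedBall_pos μ δ hε.2).ne'
    obtain ⟨t, ⟨_, hs, _, rfl, _, ⟨e, he, rfl⟩, rfl⟩, ht⟩ :=
      (meets.and (Ioo_mem_nhdsGT hε.1)).exists
    exact ⟨(t, e), ⟨ht, he⟩, hs⟩
  have tendsto_scale : Tendsto Prod.fst (𝓝[>] (0 : ℝ) ×ˢ 𝓝 δ) (𝓝 0) :=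
    tendsto_fst.mono_right nhdsWithin_le_nhds
  refine mem_tangentConeAt_of_frequently (𝓝[>] (0 : ℝ) ×ˢ 𝓝 δ) (fun p => p.1⁻¹)
    (fun p => p.1 • p.2) (by simpa using tendsto_scale.smul tendsto_snd) approachable ?_
  refine tendsto_snd.congr' ?_
  filter_upwards [tendsto_fst.eventually self_mem_nhdsWithin] with p (hp : 0 < p.1)
  exact (inv_smul_smul₀ hp.ne' p.2).symm

theorem ae_restrict_tangentConeAt_eq_univ [FiniteDimensional ℝ Y] [MeasurableSpace Y]
    [BorelSpace Y] (μ : Measure Y) [μ.IsAddHaarMeasure] (s : Set Y) :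
    ∀ᵐ y ∂μ.restrict s, tangentConeAt ℝ s y = Set.univ := by
  filter_upwards [Besicovitch.ae_tendsto_measure_inter_div μ s] with y hy
  exact Set.eq_univ_of_forall (mem_tangentConeAt_of_density_one μ hy)

theorem norm_apply_le_mul_of_eventually_norm_sub_le {g : Y → W} {c : Y → A} {g' : Y →L[ℝ] W}
    {c' : Y →L[ℝ] A} {s : Set Y} {y δ : Y} {K : ℝ} (hg : HasFDerivWithinAt g g' s y)
    (hc : HasFDerivWithinAt c c' s y) (hK : ∀ᶠ z in 𝓝[s] y, ‖g z - g y‖ ≤ K * ‖c z - c y‖)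
    (hδ : δ ∈ tangentConeAt ℝ s y) : ‖g' δ‖ ≤ K * ‖c' δ‖ := by
  obtain ⟨ι, l, _, r, d, hd, hmem, hrd⟩ := exists_fun_of_mem_tangentConeAt hδ
  have tendsto_within : Tendsto (fun i => y + d i) l (𝓝[s] y) :=
    tendsto_nhdsWithin_iff.2 ⟨by simpa using tendsto_const_nhds.add hd, hmem⟩
  refine le_of_tendsto_of_tendsto (hg.lim hd hmem hrd).norm
    ((hc.lim hd hmem hrd).norm.const_mul K) ?_
  filter_upwards [tendsto_within.eventually hK] with i hi
  calc ‖r i • (g (y + d i) - g y)‖ = ‖r i‖ * ‖g (y + d i) - g y‖ := norm_smul _ _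
    _ ≤ ‖r i‖ * (K * ‖c (y + d i) - c y‖) := by gcongr
    _ = K * ‖r i • (c (y + d i) - c y)‖ := by rw [norm_smul]; ring

theorem ae_hasFDerivAt_eq_of_eq [FiniteDimensional ℝ Y] [MeasurableSpace Y] [BorelSpace Y]
    (μ : Measure Y) [μ.IsAddHaarMeasure] (g h : Y → W) :
    ∀ᵐ y ∂μ, g y = h y → ∀ g' h' : Y →L[ℝ] W, HasFDerivAt g g' y → HasFDerivAt h h' y →
      g' = h' := by
  filter_upwards [ae_imp_of_ae_restrict (ae_restrict_tangentConeAt_eq_univ μ {y | g y = h y})]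
    with y hy heq g' h' hg hh
  ext δ
  exact hg.hasFDerivWithinAt.unique_on (hh.hasFDerivWithinAt.congr (fun _ hz => hz) heq)
    (hy heq ▸ Set.mem_univ δ)

end TangentCone

section ChainRule

open Filter Topology

variable {A Y W : Type*} [NormedAddCommGroup A] [NormedSpace ℝ A] [NormedAddCommGroup W]
  [NormedSpace ℝ W]

/-- The parameters `y` at which the increments of `a ↦ f a y` from `c y` are approximated by the
linear map `S`, up to the relative error `ε`, on the ball of radius `r`. -/
def partialApproxSet (f : A → Y → W) (c : Y → A) (S : A →L[ℝ] W) (ε r : ℝ) : Set Y :=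
  {y | ∀ u, ‖u‖ < r → ‖f (c y + u) y - f (c y) y - S u‖ ≤ ε * ‖u‖}

theorem exists_mem_partialApproxSet {f : A → Y → W} {c : Y → A} {y : Y} {T : A →L[ℝ] W}
    (hT : HasFDerivAt (fun a => f a y) T (c y)) {D : Set (A →L[ℝ] W)} (hD : Dense D) {ε : ℝ}
    (hε : 0 < ε) :
    ∃ S ∈ D, ‖S - T‖ < ε ∧ ∃ n : ℕ, y ∈ partialApproxSet f c S (2 * ε) (1 / (n + 1)) := by
  obtain ⟨S, hSD, hS⟩ := hD.exists_dist_lt T hε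
  rw [dist_comm, dist_eq_norm] at hS
  have small := (hasFDerivAt_iff_isLittleO_nhds_zero.1 hT).def hε
  obtain ⟨r, hr, small⟩ := Metric.eventually_nhds_iff.1 small
  obtain ⟨n, hn⟩ := exists_nat_one_div_lt hr
  refine ⟨S, hSD, hS, n, fun u hu => ?_⟩
  calc ‖f (c y + u) y - f (c y) y - S u‖
      = ‖(f (c y + u) y - f (c y) y - T u) - (S - T) u‖ := by
        rw [sub_apply, sub_sub_sub_cancel_right]
    _ ≤ ε * ‖u‖ + ε * ‖u‖ := norm_sub_le_of_le (small (by simpa using hu.trans hn))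
        ((S - T).le_of_opNorm_le hS.le u)
    _ = 2 * ε * ‖u‖ := by ring

variable [NormedAddCommGroup Y] [NormedSpace ℝ Y] {f : A → Y → W} {c : Y → A} {y : Y}
  {c' : Y →L[ℝ] A} {g' fy : Y →L[ℝ] W}

theorem norm_sub_sub_apply_le_of_mem_partialApproxSet {S : A →L[ℝ] W} {ε r : ℝ}
    (hr : 0 < r) (hc : HasFDerivAt c c' y)
    (hg : HasFDerivAt (fun z => f (c z) z) g' y) (hfy : HasFDerivAt (f (c y)) fy y) {δ : Y}
    (hδ : δ ∈ tangentConeAt ℝ (partialApproxSet f c S ε r) y) :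
    ‖g' δ - fy δ - S (c' δ)‖ ≤ ε * ‖c' δ‖ := by
  have hderiv : HasFDerivAt (fun z => f (c z) z - f (c y) z - S (c z)) (g' - fy - S.comp c') y :=
    (hg.sub hfy).sub (S.hasFDerivAt.comp y hc)
  refine norm_apply_le_mul_of_eventually_norm_sub_le hderiv.hasFDerivWithinAt
    hc.hasFDerivWithinAt ?_ hδ
  have close : ∀ᶠ z in 𝓝[partialApproxSet f c S ε r] y, ‖c y - c z‖ < r :=
    (hc.continuousAt.eventually (Metric.ball_mem_nhds (c y) hr)).filter_mono nhdsWithin_le_nhds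
      |>.mono fun z hz => by rwa [← dist_eq_norm, dist_comm]
  filter_upwards [self_mem_nhdsWithin, close] with z hz hclose
  calc ‖f (c z) z - f (c y) z - S (c z) - (f (c y) y - f (c y) y - S (c y))‖
      = ‖f (c z + (c y - c z)) z - f (c z) z - S (c y - c z)‖ := by
        rw [add_sub_cancel, map_sub, ← norm_neg]
        congr 1
        abel
    _ ≤ ε * ‖c z - c y‖ := norm_sub_rev (c z) (c y) ▸ hz _ hclose

theorem ae_hasFDerivAt_graph_eq_comp_add [FiniteDimensional ℝ A] [SecondCountableTopology W]
    [FiniteDimensional ℝ Y] [MeasurableSpace Y] [BorelSpace Y] (μ : Measure Y)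
    [μ.IsAddHaarMeasure] (f : A → Y → W) (c : Y → A) :
    ∀ᵐ y ∂μ, ∀ (c' : Y →L[ℝ] A) (g' fy : Y →L[ℝ] W) (fa : A →L[ℝ] W), HasFDerivAt c c' y →
      HasFDerivAt (fun z => f (c z) z) g' y → HasFDerivAt (fun a => f a y) fa (c y) →
      HasFDerivAt (f (c y)) fy y → g' = fa.comp c' + fy := by
  obtain ⟨D, hDc, hD⟩ := TopologicalSpace.exists_countable_dense (A →L[ℝ] W)
  have dense_points : ∀ᵐ y ∂μ, ∀ m : ℕ, ∀ S ∈ D, ∀ n : ℕ,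
      y ∈ partialApproxSet f c S (2 * (1 / (m + 1))) (1 / (n + 1)) →
      tangentConeAt ℝ (partialApproxSet f c S (2 * (1 / (m + 1))) (1 / (n + 1))) y = Set.univ :=
    ae_all_iff.2 fun m => (ae_ball_iff hDc).2 fun S _ => ae_all_iff.2 fun n =>
      ae_imp_of_ae_restrict (ae_restrict_tangentConeAt_eq_univ μ _)
  filter_upwards [dense_points] with y hy c' g' fy fa hc hg hfa hfy
  ext δ
  have bound (m : ℕ) : ‖g' δ - fy δ - fa (c' δ)‖ ≤ 1 / (m + 1 : ℝ) * (3 * ‖c' δ‖) := by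
    obtain ⟨S, hSD, hS, n, hmem⟩ :=
      exists_mem_partialApproxSet hfa hD (ε := 1 / (m + 1)) (by positivity)
    have hδ := norm_sub_sub_apply_le_of_mem_partialApproxSet (by positivity) hc hg hfy
      (hy m S hSD n hmem ▸ Set.mem_univ δ)
    calc ‖g' δ - fy δ - fa (c' δ)‖ = ‖(g' δ - fy δ - S (c' δ)) + (S - fa) (c' δ)‖ := by
          rw [sub_apply, sub_add_sub_cancel]
      _ ≤ 2 * (1 / (m + 1)) * ‖c' δ‖ + 1 / (m + 1) * ‖c' δ‖ :=
          norm_add_le_of_le hδ ((S - fa).le_of_opNorm_le hS.le _)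
      _ = 1 / (m + 1) * (3 * ‖c' δ‖) := by ring
  have tendsto_zero := (tendsto_one_div_add_atTop_nhds_zero_nat (𝕜 := ℝ)).mul_const (3 * ‖c' δ‖)
  have le_zero := ge_of_tendsto' tendsto_zero bound
  rw [zero_mul, norm_le_zero_iff, sub_sub, sub_eq_zero] at le_zero
  rw [le_zero, add_comm]
  rfl

theorem hasLineDerivAt_of_hasFDerivAt_comp {E : Type*} [NormedAddCommGroup E] [NormedSpace ℝ E]
    {f : E → W} {C : ℝ≥0} (hf : LipschitzWith C f) {Φ : Y → E} {Φ' : Y →L[ℝ] E}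
    (hΦ : HasFDerivAt Φ Φ' y) (hg : HasFDerivAt (fun z => f (Φ z)) g' y) (δ : Y) :
    HasLineDerivAt ℝ f (g' δ) (Φ y) (Φ' δ) := by
  have along_curve : HasDerivAt (fun t : ℝ => f (Φ (y + t • δ))) (g' δ) 0 := hg.hasLineDerivAt δ
  have curve : HasDerivAt (fun t : ℝ => Φ (y + t • δ)) (Φ' δ) 0 := hΦ.hasLineDerivAt δ
  have difference :
      HasDerivAt (fun t : ℝ => f (Φ y + t • Φ' δ) - f (Φ (y + t • δ))) 0 0 := by
    rw [hasDerivAt_iff_isLittleO]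
    refine (Asymptotics.IsBigO.of_bound C (.of_forall fun t => ?_)).trans_isLittleO
      curve.isLittleO
    have := hf.norm_sub_le (Φ (y + t • δ)) (Φ y + t • Φ' δ)
    rw [norm_sub_rev] at this
    simpa [sub_sub] using this
  have := along_curve.add difference
  simpa only [HasLineDerivAt, Pi.add_def, add_sub_cancel, add_zero] using this

theorem hasLineDerivAt_of_hasFDerivAt_graph {C : ℝ≥0}
    (hf : LipschitzWith C fun p : A × Y => f p.1 p.2) (hc : HasFDerivAt c c' y)
    (hg : HasFDerivAt (fun z => f (c z) z) g' y) (δ : Y) :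
    HasLineDerivAt ℝ (fun p : A × Y => f p.1 p.2) (g' δ) (c y, y) (c' δ, δ) :=
  hasLineDerivAt_of_hasFDerivAt_comp hf (hc.prodMk (hasFDerivAt_id y)) hg δ

end ChainRule

section PartialJacobian

variable {A Y W : Type*} [NormedAddCommGroup A] [NormedSpace ℝ A] [FiniteDimensional ℝ A]
  [NormedAddCommGroup Y] [NormedSpace ℝ Y] [NormedAddCommGroup W] [NormedSpace ℝ W]

theorem exists_clm_comp_eq_of_ker_le (B : Y →L[ℝ] A) (N : Y →L[ℝ] W)
    (hker : ∀ δ, B δ = 0 → N δ = 0) : ∃ T : A →L[ℝ] W, T.comp B = N := by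
  obtain ⟨rightInv, hrightInv⟩ := (B : Y →ₗ[ℝ] A).rangeRestrict.exists_rightInverse_of_surjective
    (LinearMap.range_rangeRestrict _)
  obtain ⟨T, hT⟩ := ((N : Y →ₗ[ℝ] W) ∘ₗ rightInv).exists_extend
  refine ⟨LinearMap.toContinuousLinearMap T, ?_⟩
  ext δ
  have hδ : B (rightInv ((B : Y →ₗ[ℝ] A).rangeRestrict δ)) = B δ :=
    congrArg Subtype.val (LinearMap.congr_fun hrightInv ((B : Y →ₗ[ℝ] A).rangeRestrict δ))
  calc T (B δ) = N (rightInv ((B : Y →ₗ[ℝ] A).rangeRestrict δ)) :=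
        LinearMap.congr_fun hT ((B : Y →ₗ[ℝ] A).rangeRestrict δ)
    _ = N δ := sub_eq_zero.1 (by rw [← map_sub]; exact hker _ (by rw [map_sub, hδ, sub_self]))

/-- `P` and `R` are partial Jacobians of `f` at `(a, y)` in its first and second argument, in the
weak sense that they are the classical ones as far as these exist: `P` is unconstrained if
`f` is not differentiable in its first argument at this point, and similarly for `R`. -/
structure ExtendsPartialFDeriv (f : A → Y → W) (a : A) (y : Y) (P : A →L[ℝ] W) (R : Y →L[ℝ] W) :
    Prop where
  fst_eq_fderiv : DifferentiableAt ℝ (fun a => f a y) a → P = fderiv ℝ (fun a => f a y) a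
  snd_eq_fderiv : DifferentiableAt ℝ (f a) y → R = fderiv ℝ (f a) y

theorem exists_extendsPartialFDeriv_eq_comp_add {f : A → Y → W} {C : ℝ≥0}
    (hf : LipschitzWith C fun p : A × Y => f p.1 p.2) {c : Y → A} {y : Y} {c' : Y →L[ℝ] A}
    {g' : Y →L[ℝ] W} (hc : HasFDerivAt c c' y) (hg : HasFDerivAt (fun z => f (c z) z) g' y)
    (hchain : ∀ (fa : A →L[ℝ] W) (fy : Y →L[ℝ] W), HasFDerivAt (fun a => f a y) fa (c y) →
      HasFDerivAt (f (c y)) fy y → g' = fa.comp c' + fy) :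
    ∃ P R, ExtendsPartialFDeriv f (c y) y P R ∧ g' = P.comp c' + R := by
  by_cases hsnd : DifferentiableAt ℝ (f (c y)) y
  · by_cases hfst : DifferentiableAt ℝ (fun a => f a y) (c y)
    · exact ⟨_, _, ⟨fun _ => rfl, fun _ => rfl⟩, hchain _ _ hfst.hasFDerivAt hsnd.hasFDerivAt⟩
    · have ker_le (δ : Y) (hδ : c' δ = 0) : (g' - fderiv ℝ (f (c y)) y) δ = 0 := by
        have vertical := hasLineDerivAt_of_hasFDerivAt_graph hf hc hg δ
        simp only [hδ, HasLineDerivAt, Prod.smul_mk, smul_zero, Prod.mk_add_mk, add_zero]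
          at vertical
        exact sub_eq_zero.2 (vertical.unique (hsnd.hasFDerivAt.hasLineDerivAt δ))
      obtain ⟨P, hP⟩ := exists_clm_comp_eq_of_ker_le c' _ ker_le
      exact ⟨P, _, ⟨fun h => absurd h hfst, fun _ => rfl⟩, by rw [hP, sub_add_cancel]⟩
  · exact ⟨_, g' - (fderiv ℝ (fun a => f a y) (c y)).comp c',
      ⟨fun _ => rfl, fun h => absurd h hsnd⟩, (add_sub_cancel _ _).symm⟩

variable [FiniteDimensional ℝ Y] [FiniteDimensional ℝ W] {ι : Type*} [Countable ι] {f : A → Y → W}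
  {C : ℝ≥0} {c : ι → Y → A} {K : ι → ℝ≥0}

theorem ae_exists_extendsPartialFDeriv_chain_rule [MeasurableSpace Y] [BorelSpace Y]
    (μ : Measure Y) [μ.IsAddHaarMeasure] (hf : LipschitzWith C fun p : A × Y => f p.1 p.2)
    (hc : ∀ i, LipschitzWith (K i) (c i)) :
    ∀ᵐ y ∂μ, ∀ a, ∃ P R, ExtendsPartialFDeriv f a y P R ∧ ∀ i, c i y = a →
      ∀ c', HasFDerivAt (c i) c' y → HasFDerivAt (fun z => f (c i z) z) (P.comp c' + R) y := by
  have graph_differentiable : ∀ᵐ y ∂μ, ∀ i, DifferentiableAt ℝ (fun z => f (c i z) z) y :=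
    ae_all_iff.2 fun i => (hf.comp ((hc i).prodMk LipschitzWith.id)).ae_differentiableAt
  have chain_rule := ae_all_iff.2 fun i => ae_hasFDerivAt_graph_eq_comp_add μ f (c i)
  have eq_of_eq := ae_all_iff.2 fun i => ae_all_iff.2 fun j =>
    ae_hasFDerivAt_eq_of_eq μ (c i) (c j)
  have graph_eq_of_eq := ae_all_iff.2 fun i => ae_all_iff.2 fun j =>
    ae_hasFDerivAt_eq_of_eq μ (fun z => f (c i z) z) (fun z => f (c j z) z)
  filter_upwards [graph_differentiable, chain_rule, eq_of_eq, graph_eq_of_eq]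
    with y graph_differentiable chain_rule eq_of_eq graph_eq_of_eq a
  by_cases hreached : ∃ i, ∃ c' : Y →L[ℝ] A, c i y = a ∧ HasFDerivAt (c i) c' y
  · obtain ⟨i, c', rfl, hci⟩ := hreached
    have hgi := (graph_differentiable i).hasFDerivAt
    obtain ⟨P, R, hPR, hsum⟩ := exists_extendsPartialFDeriv_eq_comp_add hf hci hgi
      fun fa fy => chain_rule i c' _ fy fa hci hgi
    refine ⟨P, R, hPR, fun j hj d' hcj => ?_⟩
    have hgj := (graph_differentiable j).hasFDerivAt
    rwa [eq_of_eq j i hj d' c' hcj hci, ← hsum,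
      ← graph_eq_of_eq j i (by rw [hj]) _ _ hgj hgi]
  · exact ⟨_, _, ⟨fun _ => rfl, fun _ => rfl⟩,
      fun i hi c' hci => absurd ⟨i, c', hi, hci⟩ hreached⟩

/-- `Ja` and `Jy` are versions of the partial weak Jacobians of `f`, equal to the classical partial
Jacobians wherever these exist, for which the chain rule for `y ↦ f (c i y) y` holds at almost every
`y`, simultaneously for all `i`. -/
structure ArePartialJacobiansAlong [MeasureSpace A] [MeasureSpace Y] (f : A → Y → W)
    (c : ι → Y → A) (Ja : A → Y → A →L[ℝ] W) (Jy : A → Y → Y →L[ℝ] W) : Prop where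
  isPointwiseWeakJacobian_fst : ∀ y, IsPointwiseWeakJacobian (fun a => f a y) (fun a => Ja a y)
  isPointwiseWeakJacobian_snd : ∀ a, IsPointwiseWeakJacobian (fun y => f a y) (Jy a)
  ae_hasFDerivAt : ∀ᵐ y, ∀ i c', HasFDerivAt (c i) c' y →
    HasFDerivAt (fun z => f (c i z) z) ((Ja (c i y) y).comp c' + Jy (c i y) y) y

theorem exists_arePartialJacobiansAlong [MeasureSpace A] [BorelSpace A]
    [(volume : Measure A).IsAddHaarMeasure] [MeasureSpace Y] [BorelSpace Y]
    [(volume : Measure Y).IsAddHaarMeasure] (hf : LipschitzWith C fun p : A × Y => f p.1 p.2)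
    (hc : ∀ i, LipschitzWith (K i) (c i)) : ∃ Ja Jy, ArePartialJacobiansAlong f c Ja Jy := by
  let ChainRule (a : A) (y : Y) (P : A →L[ℝ] W) (R : Y →L[ℝ] W) : Prop :=
    ∀ i, c i y = a → ∀ c', HasFDerivAt (c i) c' y →
      HasFDerivAt (fun z => f (c i z) z) (P.comp c' + R) y
  have extension (a : A) (y : Y) : ∃ P R, ExtendsPartialFDeriv f a y P R ∧
      ((∃ P R, ExtendsPartialFDeriv f a y P R ∧ ChainRule a y P R) → ChainRule a y P R) := by
    by_cases h : ∃ P R, ExtendsPartialFDeriv f a y P R ∧ ChainRule a y P R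
    · obtain ⟨P, R, hPR, hchain⟩ := h
      exact ⟨P, R, hPR, fun _ => hchain⟩
    · exact ⟨_, _, ⟨fun _ => rfl, fun _ => rfl⟩, fun h' => absurd h' h⟩
  choose Ja Jy hJ hchain using extension
  refine ⟨Ja, Jy, fun y => ?_, fun a => ?_, ?_⟩
  · exact .of_lipschitzWith (hf.comp (LipschitzWith.prodMk_right y))
      fun a => (hJ a y).fst_eq_fderiv
  · exact .of_lipschitzWith (hf.comp (LipschitzWith.prodMk_left a))
      fun y => (hJ a y).snd_eq_fderiv
  · filter_upwards [ae_exists_extendsPartialFDeriv_chain_rule volume hf hc] with y hy i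
    exact hchain _ y (hy _) i rfl

end PartialJacobian

section ProximalMap

open Filter Topology
open scoped RealInnerProductSpace

variable {X : Type*} [NormedAddCommGroup X] [InnerProductSpace ℝ X] {G : X → EReal}

namespace IsProperClosedConvex

theorem coe_mul (hG : IsProperClosedConvex G) {c : ℝ} (hc : 0 < c) :
    IsProperClosedConvex fun x => (c : EReal) * G x where
  ne_bot x := (EReal.mul_ne_bot _ _).2 ⟨.inl (EReal.coe_ne_bot c), .inr (hG.ne_bot x),
    .inl (EReal.coe_ne_top c), .inl (EReal.coe_nonneg.2 hc.le)⟩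
  exists_ne_top := hG.exists_ne_top.imp fun x hx => (EReal.mul_ne_top _ _).2
    ⟨.inl (EReal.coe_ne_bot c), .inl (EReal.coe_nonneg.2 hc.le),
      .inl (EReal.coe_ne_top c), .inr hx⟩
  closed := by
    have hc₀ : (c : EReal) ≠ 0 := EReal.coe_ne_zero.2 hc.ne'
    have hcont : Continuous fun r : EReal => (c : EReal) * r := continuous_iff_continuousAt.2
      fun r => (EReal.continuousAt_mul (p := (↑c, r)) (.inl hc₀) (.inl hc₀)
        (.inl (EReal.coe_ne_bot c)) (.inl (EReal.coe_ne_top c))).comp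
          (continuousAt_const.prodMk continuousAt_id)
    exact hcont.comp_lowerSemicontinuous hG.closed fun r s hrs =>
      mul_le_mul_of_nonneg_left hrs (EReal.coe_nonneg.2 hc.le)
  convex := by
    have epigraph_eq : {p : X × ℝ | (c : EReal) * G p.1 ≤ (p.2 : EReal)} =
        (LinearMap.id.prodMap (c⁻¹ • LinearMap.id) : X × ℝ →ₗ[ℝ] X × ℝ) ⁻¹'
          {p | G p.1 ≤ (p.2 : EReal)} := by
      ext ⟨x, s⟩
      have := EReal.le_div_iff_mul_le (EReal.coe_pos.2 hc) (EReal.coe_ne_top c)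
        (a := G x) (c := s)
      simp only [Set.mem_ofPred_eq, Set.mem_preimage, LinearMap.prodMap_apply, LinearMap.id_apply,
        LinearMap.smul_apply, smul_eq_mul, mul_comm (c : EReal), ← this, ← EReal.coe_div,
        div_eq_inv_mul]
    rw [epigraph_eq]
    exact hG.convex.linear_preimage _

theorem exists_eq_coe (hG : IsProperClosedConvex G) {x : X} (hx : G x ≠ ⊤) : ∃ r : ℝ, G x = r :=
  ⟨(G x).toReal, (EReal.coe_toReal hx (hG.ne_bot x)).symm⟩

theorem apply_add_smul_sub_le (hG : IsProperClosedConvex G) {x z : X} {r s : ℝ} (hx : G x = r)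
    (hz : G z = s) {t : ℝ} (ht : t ∈ Set.Icc (0 : ℝ) 1) :
    G (x + t • (z - x)) ≤ ((r + t * (s - r) : ℝ) : EReal) :=
  hG.convex.add_smul_sub_mem (x := (x, r)) (y := (z, s)) hx.le hz.le ht

/-- The minimum `m` on the unit ball around `x` bounds the slope of `G` along rays from `x`. -/
theorem exists_forall_sub_mul_norm_le [FiniteDimensional ℝ X] (hG : IsProperClosedConvex G)
    {x : X} {r : ℝ} (hx : G x = r) :
    ∃ m ≤ r, ∀ z (s : ℝ), G z = s → m - (r - m) * ‖z - x‖ ≤ s := by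
  obtain ⟨w, -, hmin⟩ := (hG.closed.lowerSemicontinuousOn _).exists_isMinOn
    ⟨x, Metric.mem_closedBall_self zero_le_one⟩ (isCompact_closedBall x 1)
  have hwx : G w ≤ r := hx ▸ hmin (Metric.mem_closedBall_self zero_le_one)
  obtain ⟨m, hm⟩ := hG.exists_eq_coe (ne_top_of_le_ne_top (EReal.coe_ne_top r) hwx)
  rw [hm, EReal.coe_le_coe_iff] at hwx
  refine ⟨m, hwx, fun z s hz => ?_⟩
  rcases le_or_gt ‖z - x‖ 1 with hnear | hfar
  · have hms : G w ≤ G z := hmin (mem_closedBall_iff_norm.2 hnear)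
    rw [hm, hz, EReal.coe_le_coe_iff] at hms
    linarith [mul_nonneg (sub_nonneg.2 hwx) (norm_nonneg (z - x))]
  · have hpos : 0 < ‖z - x‖ := zero_lt_one.trans hfar
    have hms : G w ≤ G (x + ‖z - x‖⁻¹ • (z - x)) := hmin (by simp [norm_smul, hpos.ne'])
    have hms := hms.trans (hG.apply_add_smul_sub_le hx hz
      ⟨inv_nonneg.2 hpos.le, inv_le_one_of_one_le₀ hfar.le⟩)
    rw [hm, EReal.coe_le_coe_iff, ← sub_le_iff_le_add', inv_mul_eq_div, le_div_iff₀ hpos] at hms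
    linarith

end IsProperClosedConvex

/-- `p` minimizes `‖z - x‖² / 2 + G z` over all `z`, the property which singles out `prox G x`. -/
def IsProxPoint (G : X → EReal) (x p : X) : Prop :=
  ∀ z : X, ((1 / 2 * ‖p - x‖ ^ 2 : ℝ) : EReal) + G p ≤ ((1 / 2 * ‖z - x‖ ^ 2 : ℝ) : EReal) + G z

theorem IsProperClosedConvex.exists_isProxPoint [FiniteDimensional ℝ X]
    (hG : IsProperClosedConvex G) (x : X) : ∃ p, IsProxPoint G x p := by
  obtain ⟨x₀, hx₀⟩ := hG.exists_ne_top
  obtain ⟨r, hr⟩ := hG.exists_eq_coe hx₀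
  obtain ⟨m, hmr, hm⟩ := hG.exists_forall_sub_mul_norm_le hr
  have hlsc : LowerSemicontinuous fun z => ((1 / 2 * ‖z - x‖ ^ 2 : ℝ) : EReal) + G z :=
    (continuous_coe_real_ereal.comp (by fun_prop)).lowerSemicontinuous.add' hG.closed fun z =>
      EReal.continuousAt_add (.inl (EReal.coe_ne_top _)) (.inl (EReal.coe_ne_bot _))
  -- Beyond this radius, the quadratic term outweighs the linear decay of `G`.
  let R := 2 * (‖x₀ - x‖ + (r - m)) + 2
  have hR : 0 ≤ R := by have := norm_nonneg (x₀ - x); simp only [R]; linarith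
  obtain ⟨p, -, hmin⟩ := (hlsc.lowerSemicontinuousOn _).exists_isMinOn
    ⟨x₀, Metric.mem_closedBall_self hR⟩ (isCompact_closedBall x₀ R)
  refine ⟨p, fun z => ?_⟩
  rcases le_or_gt ‖z - x₀‖ R with hnear | hfar
  · exact hmin (mem_closedBall_iff_norm.2 hnear)
  refine le_trans (hmin (Metric.mem_closedBall_self hR)) ?_
  by_cases hz : G z = ⊤
  · simp only [hz, EReal.coe_add_top, le_top]
  obtain ⟨s, hs⟩ := hG.exists_eq_coe hz
  have linear_decay := hm z s hs
  have far : (‖z - x₀‖ - ‖x₀ - x‖) ^ 2 ≤ ‖z - x‖ ^ 2 := by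
    refine pow_le_pow_left₀ (by simp only [R] at hfar; linarith [norm_nonneg (x₀ - x)]) ?_ 2
    rw [sub_le_iff_le_add, norm_sub_rev x₀]
    exact norm_sub_le_norm_sub_add_norm_sub z x x₀
  simp only [hr, hs, ← EReal.coe_add, EReal.coe_le_coe_iff]
  simp only [R] at hfar
  nlinarith [norm_nonneg (x₀ - x)]

theorem IsProperClosedConvex.isProxPoint_prox [FiniteDimensional ℝ X]
    (hG : IsProperClosedConvex G) (x : X) : IsProxPoint G x (prox G x) :=
  Classical.epsilon_spec (hG.exists_isProxPoint x)

namespace IsProxPoint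

variable {x y p q : X}

theorem exists_eq_coe (hp : IsProxPoint G x p) (hG : IsProperClosedConvex G) :
    ∃ g : ℝ, G p = g := by
  obtain ⟨x₀, hx₀⟩ := hG.exists_ne_top
  obtain ⟨r, hr⟩ := hG.exists_eq_coe hx₀
  refine hG.exists_eq_coe fun htop => ?_
  have := hp x₀
  rw [htop, hr, EReal.coe_add_top, ← EReal.coe_add, top_le_iff] at this
  exact EReal.coe_ne_top _ this

theorem le_add_inner (hp : IsProxPoint G x p) (hG : IsProperClosedConvex G) {z : X} {g s : ℝ}
    (hg : G p = g) (hs : G z = s) : g ≤ s + ⟪p - x, z - p⟫ := by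
  have along_segment (t : ℝ) (ht : t ∈ Set.Ioc (0 : ℝ) 1) :
      0 ≤ (s - g + ⟪p - x, z - p⟫) + t * (1 / 2 * ‖z - p‖ ^ 2) := by
    have hmin := (hp (p + t • (z - p))).trans
      (add_le_add_right (hG.apply_add_smul_sub_le hg hs ⟨ht.1.le, ht.2⟩) _)
    rw [hg, ← EReal.coe_add, ← EReal.coe_add, EReal.coe_le_coe_iff, add_sub_right_comm,
      norm_add_sq_real, inner_smul_right, norm_smul, mul_pow, Real.norm_of_nonneg ht.1.le] at hmin
    refine nonneg_of_mul_nonneg_right (?_ : 0 ≤ t * _) ht.1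
    linarith
  have tendsto_endpoint :
      Tendsto (fun t : ℝ => (s - g + ⟪p - x, z - p⟫) + t * (1 / 2 * ‖z - p‖ ^ 2))
        (𝓝[>] 0) (𝓝 ((s - g + ⟪p - x, z - p⟫) + 0 * (1 / 2 * ‖z - p‖ ^ 2))) :=
    (Continuous.tendsto (by fun_prop) 0).mono_left nhdsWithin_le_nhds
  have := ge_of_tendsto tendsto_endpoint
    (eventually_of_mem (Ioc_mem_nhdsGT zero_lt_one) along_segment)
  linarith

theorem norm_sub_sq_le_inner (hp : IsProxPoint G x p) (hq : IsProxPoint G y q)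
    (hG : IsProperClosedConvex G) : ‖p - q‖ ^ 2 ≤ ⟪x - y, p - q⟫ := by
  obtain ⟨g, hg⟩ := hp.exists_eq_coe hG
  obtain ⟨g', hg'⟩ := hq.exists_eq_coe hG
  have sum_nonneg : 0 ≤ ⟪p - x, q - p⟫ + ⟪q - y, p - q⟫ := by
    linarith [hp.le_add_inner hG hg hg', hq.le_add_inner hG hg' hg]
  have sum_eq : ⟪p - x, q - p⟫ + ⟪q - y, p - q⟫ = ⟪x - y, p - q⟫ - ‖p - q‖ ^ 2 := by
    rw [← neg_sub p q, inner_neg_right, ← real_inner_self_eq_norm_sq]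
    simp only [inner_sub_left]
    ring
  linarith

theorem norm_sub_le (hp : IsProxPoint G x p) (hq : IsProxPoint G y q)
    (hG : IsProperClosedConvex G) : ‖p - q‖ ≤ ‖x - y‖ := by
  have hsq := (hp.norm_sub_sq_le_inner hq hG).trans (real_inner_le_norm _ _)
  rw [pow_two] at hsq
  rcases (norm_nonneg (p - q)).eq_or_lt with hzero | hpos
  · exact hzero ▸ norm_nonneg _
  · exact le_of_mul_le_mul_right hsq hpos

end IsProxPoint

theorem IsProperClosedConvex.lipschitzWith_prox [FiniteDimensional ℝ X]
    (hG : IsProperClosedConvex G) : LipschitzWith 1 (prox G) :=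
  LipschitzWith.mk_one fun x y => by
    simpa only [dist_eq_norm] using (hG.isProxPoint_prox x).norm_sub_le (hG.isProxPoint_prox y) hG

end ProximalMap

section GeneralizedForwardBackward

variable {X Y Θ : Type*} [NormedAddCommGroup X] [InnerProductSpace ℝ X] {Q : ℕ} {ν : ℝ}
  {F : X → Y → Θ → ℝ} {G : Fin Q → X → Y → Θ → EReal} {a₀ : Y → Θ → X × (Fin Q → X)} {θ : Θ}

section Lipschitz

theorem lipschitzWith_pi {α ι : Type*} {β : ι → Type*} [PseudoEMetricSpace α] [Fintype ι]
    [∀ i, PseudoEMetricSpace (β i)] {f : α → ∀ i, β i} {K : ι → ℝ≥0}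
    (hf : ∀ i, LipschitzWith (K i) fun x => f x i) : LipschitzWith (Finset.univ.sup K) f :=
  fun x y => edist_pi_le_iff.2 fun i => (hf i x y).trans <| by
    gcongr
    exact Finset.le_sup (Finset.mem_univ i)

theorem lipschitzWith_gfbProx [FiniteDimensional ℝ X] (hνQ : 0 < ν * Q) {k : Fin Q} {y : Y}
    (hG : IsProperClosedConvex fun x => G k x y θ) : LipschitzWith 1 fun x => gfbProx ν G k x y θ :=
  (hG.coe_mul hνQ).lipschitzWith_prox

variable [CompleteSpace X] [PseudoEMetricSpace Y] {CF : ℝ≥0} {CG : Fin Q → ℝ≥0}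

theorem lipschitzWith_fst_fst {α β γ : Type*} [PseudoEMetricSpace α] [PseudoEMetricSpace β]
    [PseudoEMetricSpace γ] : LipschitzWith 1 fun p : (α × β) × γ => p.1.1 := fun p q =>
  (LipschitzWith.prod_fst p.1 q.1).trans <| by
    gcongr
    exact le_max_left _ _

theorem lipschitzWith_fst_snd_apply {α ι γ : Type*} {β : ι → Type*} [PseudoEMetricSpace α]
    [Fintype ι] [∀ i, PseudoEMetricSpace (β i)] [PseudoEMetricSpace γ] (i : ι) :
    LipschitzWith 1 fun p : (α × ∀ i, β i) × γ => p.1.2 i := fun p q =>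
  (edist_le_pi_edist p.1.2 q.1.2 i).trans <| (LipschitzWith.prod_snd p.1 q.1).trans <| by
    gcongr
    exact le_max_left _ _

theorem exists_lipschitzWith_gfbZ (hF : LipschitzWith CF fun p : X × Y => gradFst F p.1 p.2 θ)
    (k : Fin Q) :
    ∃ C, LipschitzWith C fun p : (X × (Fin Q → X)) × Y => gfbZ ν F k p.1 p.2 θ := by
  have gradFst_lipschitz := hF.comp
    ((lipschitzWith_fst_fst (α := X) (β := Fin Q → X) (γ := Y)).prodMk LipschitzWith.prod_snd)
  exact ⟨_, (((lipschitzWith_smul (2 : ℝ)).comp lipschitzWith_fst_fst).sub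
    (lipschitzWith_fst_snd_apply k)).sub ((lipschitzWith_smul ν).comp gradFst_lipschitz)⟩

theorem exists_lipschitzWith_gfbNewz (hF : LipschitzWith CF fun p : X × Y => gradFst F p.1 p.2 θ)
    {k : Fin Q} {C : ℝ≥0} (hG : LipschitzWith C fun p : X × Y => gfbProx ν G k p.1 p.2 θ) :
    ∃ C, LipschitzWith C fun p : (X × (Fin Q → X)) × Y => gfbNewz ν F G p.1 p.2 θ k := by
  obtain ⟨CZ, hZ⟩ := exists_lipschitzWith_gfbZ (ν := ν) hF k
  have gfbProx_lipschitz := hG.comp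
    (hZ.prodMk (LipschitzWith.prod_snd (α := X × (Fin Q → X)) (β := Y)))
  exact ⟨_, ((lipschitzWith_fst_snd_apply k).sub lipschitzWith_fst_fst).add gfbProx_lipschitz⟩

theorem exists_lipschitzWith_gfbPsi (hF : LipschitzWith CF fun p : X × Y => gradFst F p.1 p.2 θ)
    (hG : ∀ k, LipschitzWith (CG k) fun p : X × Y => gfbProx ν G k p.1 p.2 θ) :
    ∃ C, LipschitzWith C fun p : (X × (Fin Q → X)) × Y => gfbPsi ν F G p.1 p.2 θ := by
  choose C hC using fun k => exists_lipschitzWith_gfbNewz hF (hG k)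
  have newz_lipschitz := lipschitzWith_pi hC
  let average : (Fin Q → X) →L[ℝ] X := (1 / (Q : ℝ)) • ∑ k, ContinuousLinearMap.proj k
  have gfbPsi_eq (p : (X × (Fin Q → X)) × Y) : gfbPsi ν F G p.1 p.2 θ =
      (average (gfbNewz ν F G p.1 p.2 θ), gfbNewz ν F G p.1 p.2 θ) := by
    simp [average, gfbPsi]
  simp only [gfbPsi_eq]
  exact ⟨_, (average.lipschitz.comp newz_lipschitz).prodMk newz_lipschitz⟩

theorem exists_lipschitzWith_gfbA (hF : LipschitzWith CF fun p : X × Y => gradFst F p.1 p.2 θ)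
    (hG : ∀ k, LipschitzWith (CG k) fun p : X × Y => gfbProx ν G k p.1 p.2 θ) {C₀ : ℝ≥0}
    (ha₀ : LipschitzWith C₀ fun y => a₀ y θ) (ℓ : ℕ) :
    ∃ C, LipschitzWith C fun y => gfbA ν F G a₀ ℓ y θ := by
  induction ℓ with
  | zero => exact ⟨C₀, ha₀⟩
  | succ ℓ ih =>
    obtain ⟨C, hC⟩ := ih
    obtain ⟨CΨ, hΨ⟩ := exists_lipschitzWith_gfbPsi hF hG
    have step_lipschitz := hΨ.comp (hC.prodMk LipschitzWith.id)
    exact ⟨_, step_lipschitz⟩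

theorem lipschitzWith_gfbX {C : ℝ≥0} {ℓ : ℕ} (hA : LipschitzWith C fun y => gfbA ν F G a₀ ℓ y θ) :
    LipschitzWith C fun y => gfbX ν F G a₀ ℓ y θ := fun y₁ y₂ =>
  (le_max_left _ _).trans (hA y₁ y₂)

theorem lipschitzWith_gfbz {C : ℝ≥0} {ℓ : ℕ} (hA : LipschitzWith C fun y => gfbA ν F G a₀ ℓ y θ)
    (k : Fin Q) : LipschitzWith C fun y => gfbz ν F G a₀ ℓ k y θ := fun y₁ y₂ =>
  (edist_le_pi_edist _ _ k).trans ((le_max_right _ _).trans (hA y₁ y₂))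

theorem exists_lipschitzWith_gfbZIter
    (hF : LipschitzWith CF fun p : X × Y => gradFst F p.1 p.2 θ) {C : ℝ≥0} {ℓ : ℕ}
    (hA : LipschitzWith C fun y => gfbA ν F G a₀ ℓ y θ) (k : Fin Q) :
    ∃ C, LipschitzWith C fun y => gfbZIter ν F G a₀ ℓ k y θ := by
  obtain ⟨CZ, hZ⟩ := exists_lipschitzWith_gfbZ (ν := ν) hF k
  exact ⟨_, hZ.comp (hA.prodMk LipschitzWith.id)⟩

end Lipschitz

section Derivative

variable [CompleteSpace X] [NormedAddCommGroup Y] [NormedSpace ℝ Y] {ℓ : ℕ} {k : Fin Q} {y : Y}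
  {x' z' : Y →L[ℝ] X}

theorem hasFDerivAt_gfbA {z' : Fin Q → Y →L[ℝ] X}
    (hx : HasFDerivAt (fun y => gfbX ν F G a₀ ℓ y θ) x' y)
    (hz : ∀ k, HasFDerivAt (fun y => gfbz ν F G a₀ ℓ k y θ) (z' k) y) :
    HasFDerivAt (fun y => gfbA ν F G a₀ ℓ y θ) (x'.prod (.pi z')) y :=
  hx.prodMk (hasFDerivAt_pi.2 hz)

theorem hasFDerivAt_gfbX_succ {z' : Fin Q → Y →L[ℝ] X}
    (hz : ∀ k, HasFDerivAt (fun y => gfbz ν F G a₀ (ℓ + 1) k y θ) (z' k) y) :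
    HasFDerivAt (fun y => gfbX ν F G a₀ (ℓ + 1) y θ) ((1 / (Q : ℝ)) • ∑ k, z' k) y :=
  (HasFDerivAt.fun_sum fun k _ => hz k).const_smul (1 / (Q : ℝ))

theorem hasFDerivAt_gfbz_succ {p' : Y →L[ℝ] X}
    (hz : HasFDerivAt (fun y => gfbz ν F G a₀ ℓ k y θ) z' y)
    (hx : HasFDerivAt (fun y => gfbX ν F G a₀ ℓ y θ) x' y)
    (hp : HasFDerivAt (fun y => gfbProx ν G k (gfbZIter ν F G a₀ ℓ k y θ) y θ) p' y) :
    HasFDerivAt (fun y => gfbz ν F G a₀ (ℓ + 1) k y θ) (z' - x' + p') y :=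
  (hz.sub hx).add hp

theorem hasFDerivAt_gfbZIter {f' : Y →L[ℝ] X}
    (hx : HasFDerivAt (fun y => gfbX ν F G a₀ ℓ y θ) x' y)
    (hz : HasFDerivAt (fun y => gfbz ν F G a₀ ℓ k y θ) z' y)
    (hf : HasFDerivAt (fun y => gradFst F (gfbX ν F G a₀ ℓ y θ) y θ) f' y) :
    HasFDerivAt (fun y => gfbZIter ν F G a₀ ℓ k y θ) ((2 : ℝ) • x' - z' - ν • f') y :=
  ((hx.const_smul (2 : ℝ)).sub hz).sub (hf.const_smul ν)

end Derivative

instance isAddHaarMeasure_volume_prod_pi {E ι : Type*} [Fintype ι] [NormedAddCommGroup E]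
    [NormedSpace ℝ E] [FiniteDimensional ℝ E] [MeasureSpace E] [BorelSpace E]
    [(volume : Measure E).IsAddHaarMeasure] :
    (volume : Measure (E × (ι → E))).IsAddHaarMeasure :=
  have : (volume : Measure (ι → E)).IsAddHaarMeasure :=
    inferInstanceAs (Measure.pi _).IsAddHaarMeasure
  inferInstanceAs ((volume : Measure E).prod (volume : Measure (ι → E))).IsAddHaarMeasure

end GeneralizedForwardBackward

section DifferentiatedIteration

variable {X Y Θ : Type*} [NormedAddCommGroup X] [InnerProductSpace ℝ X] [CompleteSpace X]
  [NormedAddCommGroup Y] [NormedSpace ℝ Y] {Q : ℕ}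

/-- The differentiated Generalized Forward-Backward iteration at step `ℓ`, at the point `y` and in
the direction `δ`: the Jacobians `Da`, `Dx`, `Dz`, `DZ` of the iterates satisfy the recursion whose
coefficients are the Jacobians `Γ` of `γ`, `Ψa`, `Ψy` of `ψ`, `Gx`, `Gy` of the proximal maps and
`Fx`, `Fy` of `∇₁F`, and each sum of two partial derivatives is a joint directional derivative. -/
def IsDifferentiatedGFBStep (ν : ℝ) (F : X → Y → Θ → ℝ) (G : Fin Q → X → Y → Θ → EReal)
    (a₀ : Y → Θ → X × (Fin Q → X)) (θ : Θ)
    (Γ : X × (Fin Q → X) → (X × (Fin Q → X)) →L[ℝ] X)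
    (Ψa : X × (Fin Q → X) → Y → (X × (Fin Q → X)) →L[ℝ] (X × (Fin Q → X)))
    (Ψy : X × (Fin Q → X) → Y → Y →L[ℝ] (X × (Fin Q → X)))
    (Gx : Fin Q → X → Y → X →L[ℝ] X) (Gy : Fin Q → X → Y → Y →L[ℝ] X)
    (Fx : X → Y → X →L[ℝ] X) (Fy : X → Y → Y →L[ℝ] X)
    (Da : ℕ → Y → Y →L[ℝ] (X × (Fin Q → X))) (Dx : ℕ → Y → Y →L[ℝ] X)
    (Dz DZ : ℕ → Fin Q → Y → Y →L[ℝ] X) (y δ : Y) (ℓ : ℕ) : Prop :=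
  Da ℓ y δ = (Dx ℓ y δ, fun k => Dz ℓ k y δ) ∧
  Dx ℓ y δ = Γ (gfbA ν F G a₀ ℓ y θ) (Da ℓ y δ) ∧
  Da (ℓ + 1) y δ
    = Ψa (gfbA ν F G a₀ ℓ y θ) y (Da ℓ y δ) + Ψy (gfbA ν F G a₀ ℓ y θ) y δ ∧
  Dx (ℓ + 1) y δ = (1 / (Q : ℝ)) • ∑ k, Dz (ℓ + 1) k y δ ∧
  (∀ k, Dz (ℓ + 1) k y δ
    = Dz ℓ k y δ - Dx ℓ y δ
      + Gx k (gfbZIter ν F G a₀ ℓ k y θ) y (DZ ℓ k y δ)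
      + Gy k (gfbZIter ν F G a₀ ℓ k y θ) y δ) ∧
  (∀ k, DZ ℓ k y δ
    = (2 : ℝ) • Dx ℓ y δ - Dz ℓ k y δ
      - ν • (Fx (gfbX ν F G a₀ ℓ y θ) y (Dx ℓ y δ)
        + Fy (gfbX ν F G a₀ ℓ y θ) y δ)) ∧
  HasLineDerivAt ℝ
    (fun p : (X × (Fin Q → X)) × Y => gfbPsi ν F G p.1 p.2 θ)
    (Ψa (gfbA ν F G a₀ ℓ y θ) y (Da ℓ y δ) + Ψy (gfbA ν F G a₀ ℓ y θ) y δ)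
    (gfbA ν F G a₀ ℓ y θ, y) (Da ℓ y δ, δ) ∧
  (∀ k, HasLineDerivAt ℝ (fun p : X × Y => gfbProx ν G k p.1 p.2 θ)
    (Gx k (gfbZIter ν F G a₀ ℓ k y θ) y (DZ ℓ k y δ)
      + Gy k (gfbZIter ν F G a₀ ℓ k y θ) y δ)
    (gfbZIter ν F G a₀ ℓ k y θ, y) (DZ ℓ k y δ, δ)) ∧
  HasLineDerivAt ℝ (fun p : X × Y => gradFst F p.1 p.2 θ)
    (Fx (gfbX ν F G a₀ ℓ y θ) y (Dx ℓ y δ) + Fy (gfbX ν F G a₀ ℓ y θ) y δ)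
    (gfbX ν F G a₀ ℓ y θ, y) (Dx ℓ y δ, δ)

variable {ν : ℝ} {F : X → Y → Θ → ℝ} {G : Fin Q → X → Y → Θ → EReal}
  {a₀ : Y → Θ → X × (Fin Q → X)} {θ : Θ}
  {Ψa : X × (Fin Q → X) → Y → (X × (Fin Q → X)) →L[ℝ] (X × (Fin Q → X))}
  {Ψy : X × (Fin Q → X) → Y → Y →L[ℝ] (X × (Fin Q → X))}
  {Gx : Fin Q → X → Y → X →L[ℝ] X} {Gy : Fin Q → X → Y → Y →L[ℝ] X}
  {Fx : X → Y → X →L[ℝ] X} {Fy : X → Y → Y →L[ℝ] X}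
  {Da : ℕ → Y → Y →L[ℝ] (X × (Fin Q → X))} {Dx : ℕ → Y → Y →L[ℝ] X}
  {Dz DZ : ℕ → Fin Q → Y → Y →L[ℝ] X} {CΨ CF : ℝ≥0} {CG : Fin Q → ℝ≥0} {y : Y} {ℓ : ℕ}

theorem isDifferentiatedGFBStep_of_hasFDerivAt
    (hΨ : LipschitzWith CΨ fun p : (X × (Fin Q → X)) × Y => gfbPsi ν F G p.1 p.2 θ)
    (hProx : ∀ k, LipschitzWith (CG k) fun p : X × Y => gfbProx ν G k p.1 p.2 θ)
    (hF : LipschitzWith CF fun p : X × Y => gradFst F p.1 p.2 θ)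
    (hDa : ∀ ℓ, HasFDerivAt (fun y => gfbA ν F G a₀ ℓ y θ) (Da ℓ y) y)
    (hDx : ∀ ℓ, HasFDerivAt (fun y => gfbX ν F G a₀ ℓ y θ) (Dx ℓ y) y)
    (hDz : ∀ ℓ k, HasFDerivAt (fun y => gfbz ν F G a₀ ℓ k y θ) (Dz ℓ k y) y)
    (hDZ : ∀ k, HasFDerivAt (fun y => gfbZIter ν F G a₀ ℓ k y θ) (DZ ℓ k y) y)
    (hΨ' : HasFDerivAt (fun y => gfbPsi ν F G (gfbA ν F G a₀ ℓ y θ) y θ)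
      ((Ψa (gfbA ν F G a₀ ℓ y θ) y).comp (Da ℓ y) + Ψy (gfbA ν F G a₀ ℓ y θ) y) y)
    (hProx' : ∀ k, HasFDerivAt (fun y => gfbProx ν G k (gfbZIter ν F G a₀ ℓ k y θ) y θ)
      ((Gx k (gfbZIter ν F G a₀ ℓ k y θ) y).comp (DZ ℓ k y)
        + Gy k (gfbZIter ν F G a₀ ℓ k y θ) y) y)
    (hF' : HasFDerivAt (fun y => gradFst F (gfbX ν F G a₀ ℓ y θ) y θ)
      ((Fx (gfbX ν F G a₀ ℓ y θ) y).comp (Dx ℓ y) + Fy (gfbX ν F G a₀ ℓ y θ) y) y) (δ : Y) :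
    IsDifferentiatedGFBStep ν F G a₀ θ (fun _ => .fst ℝ X (Fin Q → X)) Ψa Ψy Gx Gy Fx Fy
      Da Dx Dz DZ y δ ℓ := by
  have Da_eq : Da ℓ y δ = (Dx ℓ y δ, fun k => Dz ℓ k y δ) :=
    DFunLike.congr_fun ((hDa ℓ).unique (hasFDerivAt_gfbA (hDx ℓ) (hDz ℓ))) δ
  have Da_succ_eq := (hDa (ℓ + 1)).unique hΨ'
  have Dx_succ_eq := (hDx (ℓ + 1)).unique (hasFDerivAt_gfbX_succ (hDz (ℓ + 1)))
  have Dz_succ_eq k := (hDz (ℓ + 1) k).unique (hasFDerivAt_gfbz_succ (hDz ℓ k) (hDx ℓ) (hProx' k))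
  have DZ_eq k := (hDZ k).unique (hasFDerivAt_gfbZIter (hDx ℓ) (hDz ℓ k) hF')
  exact ⟨Da_eq, (congrArg Prod.fst Da_eq).symm, by simp [Da_succ_eq], by simp [Dx_succ_eq],
    fun k => by simp [Dz_succ_eq, add_assoc], fun k => by simp [DZ_eq],
    hasLineDerivAt_of_hasFDerivAt_graph (f := fun a y => gfbPsi ν F G a y θ) hΨ (hDa ℓ) hΨ' δ,
    fun k => hasLineDerivAt_of_hasFDerivAt_graph (f := fun x y => gfbProx ν G k x y θ) (hProx k)
      (hDZ k) (hProx' k) δ,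
    hasLineDerivAt_of_hasFDerivAt_graph (f := fun x y => gradFst F x y θ) hF (hDx ℓ) hF' δ⟩

end DifferentiatedIteration

theorem mainTheorem8_general
    {X Y Θ : Type*}
    [NormedAddCommGroup X] [InnerProductSpace ℝ X] [FiniteDimensional ℝ X]
    [MeasurableSpace X] [BorelSpace X]
    [NormedAddCommGroup Y] [NormedSpace ℝ Y] [FiniteDimensional ℝ Y]
    [MeasureSpace Y] [BorelSpace Y] [(volume : Measure Y).IsAddHaarMeasure]
    {Q : ℕ} (hQ : 0 < Q) (ν : ℝ) (hν : 0 < ν) (L : ℝ≥0)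
    (F : X → Y → Θ → ℝ) (G : Fin Q → X → Y → Θ → EReal)
    (a₀ : Y → Θ → X × (Fin Q → X)) (θ : Θ)
    (_hF_diff : ∀ y, Differentiable ℝ (fun x => F x y θ))
    (hF_lip : ∀ y, LipschitzWith L (fun x => gradFst F x y θ))
    (hG : ∀ k y, IsProperClosedConvex (fun x => G k x y θ))
    (hF_lip_y : ∃ C : ℝ≥0, ∀ x, LipschitzWith C (fun y => gradFst F x y θ))
    (hG_lip_y : ∀ k, ∃ C : ℝ≥0, ∀ x, LipschitzWith C (fun y => gfbProx ν G k x y θ))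
    (ha₀ : ∃ C : ℝ≥0, LipschitzWith C (fun y => a₀ y θ)) :
    (∀ ℓ, WeaklyDifferentiable (fun y => gfbA ν F G a₀ ℓ y θ)) ∧
    (∀ ℓ, WeaklyDifferentiable (fun y => gfbX ν F G a₀ ℓ y θ)) ∧
    (∀ ℓ k, WeaklyDifferentiable (fun y => gfbz ν F G a₀ ℓ k y θ)) ∧
    (∀ ℓ k, WeaklyDifferentiable (fun y => gfbZIter ν F G a₀ ℓ k y θ)) ∧
    ∃ (Γ : X × (Fin Q → X) → (X × (Fin Q → X)) →L[ℝ] X)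
      (Ψa : X × (Fin Q → X) → Y → (X × (Fin Q → X)) →L[ℝ] (X × (Fin Q → X)))
      (Ψy : X × (Fin Q → X) → Y → Y →L[ℝ] (X × (Fin Q → X)))
      (Gx : Fin Q → X → Y → X →L[ℝ] X) (Gy : Fin Q → X → Y → Y →L[ℝ] X)
      (Fx : X → Y → X →L[ℝ] X) (Fy : X → Y → Y →L[ℝ] X),
      IsPointwiseWeakJacobian (fun a : X × (Fin Q → X) => gfbGamma a) Γ ∧
      (∀ y, IsPointwiseWeakJacobian (fun a => gfbPsi ν F G a y θ) (fun a => Ψa a y)) ∧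
      (∀ a, IsPointwiseWeakJacobian (fun y => gfbPsi ν F G a y θ) (fun y => Ψy a y)) ∧
      (∀ k y, IsPointwiseWeakJacobian (fun x => gfbProx ν G k x y θ) (fun x => Gx k x y)) ∧
      (∀ k x, IsPointwiseWeakJacobian (fun y => gfbProx ν G k x y θ) (fun y => Gy k x y)) ∧
      (∀ y, IsPointwiseWeakJacobian (fun x => gradFst F x y θ) (fun x => Fx x y)) ∧
      (∀ x, IsPointwiseWeakJacobian (fun y => gradFst F x y θ) (fun y => Fy x y)) ∧
      ∀ (Da : ℕ → Y → Y →L[ℝ] (X × (Fin Q → X))) (Dx : ℕ → Y → Y →L[ℝ] X)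
        (Dz DZ : ℕ → Fin Q → Y → Y →L[ℝ] X),
        (∀ ℓ, IsWeakJacobian (fun y => gfbA ν F G a₀ ℓ y θ) (Da ℓ)) →
        (∀ ℓ, IsWeakJacobian (fun y => gfbX ν F G a₀ ℓ y θ) (Dx ℓ)) →
        (∀ ℓ k, IsWeakJacobian (fun y => gfbz ν F G a₀ ℓ k y θ) (Dz ℓ k)) →
        (∀ ℓ k, IsWeakJacobian (fun y => gfbZIter ν F G a₀ ℓ k y θ) (DZ ℓ k)) →
        ∀ᵐ y ∂(volume : Measure Y), ∀ (δ : Y) (ℓ : ℕ),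
          IsDifferentiatedGFBStep ν F G a₀ θ Γ Ψa Ψy Gx Gy Fx Fy Da Dx Dz DZ y δ ℓ := by
  obtain ⟨CF, hCF⟩ := hF_lip_y
  choose CG hCG using hG_lip_y
  have hF := LipschitzWith.uncurry (f := fun x y => gradFst F x y θ) hF_lip hCF
  have hProx := fun k => LipschitzWith.uncurry (f := fun x y => gfbProx ν G k x y θ)
    (fun y => lipschitzWith_gfbProx (by positivity) (hG k y)) (hCG k)
  obtain ⟨CΨ, hΨ⟩ := exists_lipschitzWith_gfbPsi (ν := ν) hF hProx
  obtain ⟨C₀, hC₀⟩ := ha₀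
  choose CA hA using exists_lipschitzWith_gfbA hF hProx hC₀
  choose CZ hZ using fun ℓ => exists_lipschitzWith_gfbZIter hF (hA ℓ)
  have hX := fun ℓ => lipschitzWith_gfbX (hA ℓ)
  have hz := fun ℓ => lipschitzWith_gfbz (hA ℓ)
  refine ⟨fun ℓ => .of_lipschitzWith (hA ℓ), fun ℓ => .of_lipschitzWith (hX ℓ),
    fun ℓ k => .of_lipschitzWith (hz ℓ k), fun ℓ k => .of_lipschitzWith (hZ ℓ k), ?_⟩
  obtain ⟨Ψa, Ψy, hΨJ⟩ := exists_arePartialJacobiansAlong (f := fun a y => gfbPsi ν F G a y θ) hΨ hA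
  obtain ⟨Fx, Fy, hFJ⟩ := exists_arePartialJacobiansAlong (f := fun x y => gradFst F x y θ) hF hX
  choose Gx Gy hGJ using fun k => exists_arePartialJacobiansAlong
    (f := fun x y => gfbProx ν G k x y θ) (hProx k) fun ℓ => hZ ℓ k
  refine ⟨fun _ => .fst ℝ X (Fin Q → X), Ψa, Ψy, Gx, Gy, Fx, Fy,
    .of_lipschitzWith LipschitzWith.prod_fst fun a _ => hasFDerivAt_fst.fderiv.symm,
    hΨJ.isPointwiseWeakJacobian_fst, hΨJ.isPointwiseWeakJacobian_snd,
    fun k => (hGJ k).isPointwiseWeakJacobian_fst, fun k => (hGJ k).isPointwiseWeakJacobian_snd,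
    hFJ.isPointwiseWeakJacobian_fst, hFJ.isPointwiseWeakJacobian_snd, ?_⟩
  intro Da Dx Dz DZ hDa hDx hDz hDZ
  filter_upwards [hΨJ.ae_hasFDerivAt, hFJ.ae_hasFDerivAt,
    ae_all_iff.2 fun k => (hGJ k).ae_hasFDerivAt,
    ae_all_iff.2 fun ℓ => (hDa ℓ).ae_hasFDerivAt (hA ℓ),
    ae_all_iff.2 fun ℓ => (hDx ℓ).ae_hasFDerivAt (hX ℓ),
    ae_all_iff.2 fun ℓ => ae_all_iff.2 fun k => (hDz ℓ k).ae_hasFDerivAt (hz ℓ k),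
    ae_all_iff.2 fun ℓ => ae_all_iff.2 fun k => (hDZ ℓ k).ae_hasFDerivAt (hZ ℓ k)]
    with y hΨ' hF' hProx' hDa hDx hDz hDZ δ ℓ
  exact isDifferentiatedGFBStep_of_hasFDerivAt hΨ hProx hF hDa hDx hDz (hDZ ℓ)
    (hΨ' ℓ _ (hDa ℓ)) (fun k => hProx' k ℓ _ (hDZ ℓ k)) (hF' ℓ _ (hDx ℓ)) δ

theorem mainTheorem8
    {X Y Θ : Type*}
    [NormedAddCommGroup X] [InnerProductSpace ℝ X] [FiniteDimensional ℝ X]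
    [MeasurableSpace X] [BorelSpace X]
    [NormedAddCommGroup Y] [InnerProductSpace ℝ Y] [FiniteDimensional ℝ Y]
    [MeasurableSpace Y] [BorelSpace Y]
    {Q : ℕ} (hQ : 0 < Q) (ν : ℝ) (hν : 0 < ν) (L : ℝ≥0)
    (F : X → Y → Θ → ℝ) (G : Fin Q → X → Y → Θ → EReal)
    (a₀ : Y → Θ → X × (Fin Q → X)) (θ : Θ)
    -- the structural assumptions of the splitting
    (hF_conv : ∀ y, ConvexOn ℝ Set.univ (fun x => F x y θ))
    (hF_diff : ∀ y, ContDiff ℝ 1 (fun x => F x y θ))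
    (hF_lip : ∀ y, LipschitzWith L (fun x => gradFst F x y θ))
    (hG : ∀ k y, IsProperClosedConvex (fun x => G k x y θ))
    -- the Lipschitz assumptions with respect to `y`
    (hF_lip_y : ∃ C : ℝ≥0, ∀ x, LipschitzWith C (fun y => gradFst F x y θ))
    (hG_lip_y : ∀ k, ∃ C : ℝ≥0, ∀ x, LipschitzWith C (fun y => gfbProx ν G k x y θ))
    (ha₀ : ∃ C : ℝ≥0, LipschitzWith C (fun y => a₀ y θ)) :
    -- all iterates are weakly differentiable in `y`
    (∀ ℓ, WeaklyDifferentiable (fun y => gfbA ν F G a₀ ℓ y θ)) ∧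
    (∀ ℓ, WeaklyDifferentiable (fun y => gfbX ν F G a₀ ℓ y θ)) ∧
    (∀ ℓ k, WeaklyDifferentiable (fun y => gfbz ν F G a₀ ℓ k y θ)) ∧
    (∀ ℓ k, WeaklyDifferentiable (fun y => gfbZIter ν F G a₀ ℓ k y θ)) ∧
    -- versions of the weak Jacobians of `γ`, `ψ`, of the proximal maps and of `∇₁F`
    ∃ (Γ : X × (Fin Q → X) → (X × (Fin Q → X)) →L[ℝ] X)
      (Ψa : X × (Fin Q → X) → Y → (X × (Fin Q → X)) →L[ℝ] (X × (Fin Q → X)))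
      (Ψy : X × (Fin Q → X) → Y → Y →L[ℝ] (X × (Fin Q → X)))
      (Gx : Fin Q → X → Y → X →L[ℝ] X) (Gy : Fin Q → X → Y → Y →L[ℝ] X)
      (Fx : X → Y → X →L[ℝ] X) (Fy : X → Y → Y →L[ℝ] X),
      IsPointwiseWeakJacobian (fun a : X × (Fin Q → X) => gfbGamma a) Γ ∧
      (∀ y, IsPointwiseWeakJacobian (fun a => gfbPsi ν F G a y θ) (fun a => Ψa a y)) ∧
      (∀ a, IsPointwiseWeakJacobian (fun y => gfbPsi ν F G a y θ) (fun y => Ψy a y)) ∧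
      (∀ k y, IsPointwiseWeakJacobian (fun x => gfbProx ν G k x y θ) (fun x => Gx k x y)) ∧
      (∀ k x, IsPointwiseWeakJacobian (fun y => gfbProx ν G k x y θ) (fun y => Gy k x y)) ∧
      (∀ y, IsPointwiseWeakJacobian (fun x => gradFst F x y θ) (fun x => Fx x y)) ∧
      (∀ x, IsPointwiseWeakJacobian (fun y => gradFst F x y θ) (fun y => Fy x y)) ∧
      -- whatever versions of the weak Jacobians of the iterates are taken
      ∀ (Da : ℕ → Y → Y →L[ℝ] (X × (Fin Q → X))) (Dx : ℕ → Y → Y →L[ℝ] X)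
        (Dz DZ : ℕ → Fin Q → Y → Y →L[ℝ] X),
        (∀ ℓ, IsWeakJacobian (fun y => gfbA ν F G a₀ ℓ y θ) (Da ℓ)) →
        (∀ ℓ, IsWeakJacobian (fun y => gfbX ν F G a₀ ℓ y θ) (Dx ℓ)) →
        (∀ ℓ k, IsWeakJacobian (fun y => gfbz ν F G a₀ ℓ k y θ) (Dz ℓ k)) →
        (∀ ℓ k, IsWeakJacobian (fun y => gfbZIter ν F G a₀ ℓ k y θ) (DZ ℓ k)) →
        ∀ᵐ y ∂(volume : Measure Y), ∀ (δ : Y) (ℓ : ℕ),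
          Da ℓ y δ = (Dx ℓ y δ, fun k => Dz ℓ k y δ) ∧
          Dx ℓ y δ = Γ (gfbA ν F G a₀ ℓ y θ) (Da ℓ y δ) ∧
          Da (ℓ + 1) y δ
            = Ψa (gfbA ν F G a₀ ℓ y θ) y (Da ℓ y δ) + Ψy (gfbA ν F G a₀ ℓ y θ) y δ ∧
          Dx (ℓ + 1) y δ = (1 / (Q : ℝ)) • ∑ k, Dz (ℓ + 1) k y δ ∧
          (∀ k, Dz (ℓ + 1) k y δ
            = Dz ℓ k y δ - Dx ℓ y δ
              + Gx k (gfbZIter ν F G a₀ ℓ k y θ) y (DZ ℓ k y δ)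
              + Gy k (gfbZIter ν F G a₀ ℓ k y θ) y δ) ∧
          (∀ k, DZ ℓ k y δ
            = (2 : ℝ) • Dx ℓ y δ - Dz ℓ k y δ
              - ν • (Fx (gfbX ν F G a₀ ℓ y θ) y (Dx ℓ y δ)
                + Fy (gfbX ν F G a₀ ℓ y θ) y δ)) ∧
          -- the derivative terms are the directional derivatives of `ψ`, `Prox`, `∇₁F`
          HasLineDerivAt ℝ
            (fun p : (X × (Fin Q → X)) × Y => gfbPsi ν F G p.1 p.2 θ)
            (Ψa (gfbA ν F G a₀ ℓ y θ) y (Da ℓ y δ) + Ψy (gfbA ν F G a₀ ℓ y θ) y δ)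
            (gfbA ν F G a₀ ℓ y θ, y) (Da ℓ y δ, δ) ∧
          (∀ k, HasLineDerivAt ℝ (fun p : X × Y => gfbProx ν G k p.1 p.2 θ)
            (Gx k (gfbZIter ν F G a₀ ℓ k y θ) y (DZ ℓ k y δ)
              + Gy k (gfbZIter ν F G a₀ ℓ k y θ) y δ)
            (gfbZIter ν F G a₀ ℓ k y θ, y) (DZ ℓ k y δ, δ)) ∧
          HasLineDerivAt ℝ (fun p : X × Y => gradFst F p.1 p.2 θ)
            (Fx (gfbX ν F G a₀ ℓ y θ) y (Dx ℓ y δ) + Fy (gfbX ν F G a₀ ℓ y θ) y δ)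
            (gfbX ν F G a₀ ℓ y θ, y) (Dx ℓ y δ, δ) :=
  mainTheorem8_general hQ ν hν L F G a₀ θ (fun y => (hF_diff y).differentiable one_ne_zero)
    hF_lip hG hF_lip_y hG_lip_y ha₀
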